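/- Let $\mathcal H$ be a complex Hilbert space, with scalar product linear in the second entry. Let $S$ be a densely defined symmetric operator in $\mathcal H$, with closure $\overline S$, such that $0$ is a point of regular type of $\overline S$ (i.e. there is $c>0$ with $\|\overline S f\|\ge c\|f\|$ for all $f\in\mathcal D(\overline S)$) and $\dim\ker S^*\ge 1$. Let $S_{\mathrm D}$ be a self-adjoint extension of $S$ with everywhere defined and bounded inverse, and let $\widetilde S$ be a self-adjoint extension of $S$. For every $\varepsilon>0$ there is a unique unitary $U_\varepsilon:\ker(S^*-\mathrm i\varepsilon)\to\ker(S^*+\mathrm i\varepsilon)$ (the von Neumann parameter of $\widetilde S$) such that $$\mathcal D(\widetilde S)=\mathcal D(\overline S)+(1-U_\varepsilon)\ker(S^*-\mathrm i\varepsilon),\qquad \widetilde S(f+u-U_\varepsilon u)=\overline S f+\mathrm i\varepsilon u+\mathrm i\varepsilon U_\varepsilon u,$$ and there is a unique self-adjoint operator $T$ acting in a closed subspace of $\ker S^*$ (the Kreĭn–Višik–Birman parameter of $\widetilde S$ relative to $S_{\mathrm D}$) such that $$\mathcal D(\widetilde S)=\{f+S_{\mathrm D}^{-1}(Tu+w)+u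 \mid f\in\mathcal D(\overline S),\ u\in\mathcal D(T),\ w\in\ker S^*\cap\mathcal D(T)^\perp\},$$ $$\widetilde S\big(f+S_{\mathrm D}^{-1}(Tu+w)+u\big)=\overline S f+Tu+w .$$ For every $\varepsilon>0$, each $g\in\mathcal D(\widetilde S)$ is uniquely decomposed as $g=f_\varepsilon^{(g)}+u_\varepsilon^{(g)}-U_\varepsilon u_\varepsilon^{(g)}$ with $f_\varepsilon^{(g)}\in\mathcal D(\overline S)$ and $u_\varepsilon^{(g)}\in\ker(S^*-\mathrm i\varepsilon)$. Moreover, for every $g\in\mathcal D(\widetilde S)$ the limit $$u^{(g)}:=\lim_{\varepsilon\downarrow0}(1-S_{\mathrm D}^{-1}\widetilde S)\big(u_\varepsilon^{(g)}-U_\varepsilon u_\varepsilon^{(g)}\big)$$ exists in $\mathcal H$ and belongs to $\mathcal D(T)\subset\ker S^*$; one has $$\mathcal D(T)=\{u^{(g)}\mid g\in\mathcal D(\widetilde S)\};$$ and for every $g\in\mathcal D(\widetilde S)$ $$\langle u^{(g)},Tu^{(g)}\rangle=\lim_{\varepsilon\downarrow0}\mathrm i\varepsilon\,\big\langle(1-S_{\mathrm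 D}^{-1}\widetilde S)(u_\varepsilon^{(g)}-U_\varepsilon u_\varepsilon^{(g)}),\,u_\varepsilon^{(g)}+U_\varepsilon u_\varepsilon^{(g)}\big\rangle .$$ -/

import Mathlib

open Filter Topology
open scoped LinearPMap

namespace ExtensionTheory

noncomputable section

variable {H : Type*} [NormedAddCommGroup H] [InnerProductSpace ℂ H]

/-- `z` is a point of regular type of the operator `A`: `A - z` is injective with bounded inverse
on its range. -/
def IsRegularPoint (A : H →ₗ.[ℂ] H) (z : ℂ) : Prop :=
  ∃ c : ℝ, 0 < c ∧ ∀ f : A.domain, c * ‖(f : H)‖ ≤ ‖A f - z • (f : H)‖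

/-- `B` is the everywhere defined and bounded inverse of the operator `A`. -/
structure IsBoundedInverse (A : H →ₗ.[ℂ] H) (B : H →L[ℂ] H) : Prop where
  left_inv : ∀ x : A.domain, B (A x) = x
  mem_domain : ∀ y : H, B y ∈ A.domain
  right_inv : ∀ y : H, A ⟨B y, mem_domain y⟩ = y

/-- The map `1 - B A` on the domain of `A`. -/
def oneSubComp (B : H →L[ℂ] H) (A : H →ₗ.[ℂ] H) : A.domain →ₗ[ℂ] H :=
  A.domain.subtype - B.toLinearMap ∘ₗ A.toFun

/-- A self-adjoint operator acting in a closed subspace of `N`: a closed subspace `space` of `H`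
contained in `N`, and a self-adjoint operator in the Hilbert space `space`. -/
structure SelfAdjointIn [CompleteSpace H] (N : Submodule ℂ H) where
  space : Submodule ℂ H
  space_le : space ≤ N
  isClosed : IsClosed (space : Set H)
  op : space →ₗ.[ℂ] space
  isSelfAdjoint : haveI : CompleteSpace space := isClosed.completeSpace_coe
    IsSelfAdjoint op

namespace SelfAdjointIn

variable [CompleteSpace H] {N : Submodule ℂ H}

/-- The domain of the operator, as a subspace of `H`. -/
def dom (T : SelfAdjointIn N) : Submodule ℂ H :=
  T.op.domain.map T.space.subtype

end SelfAdjointIn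

variable [CompleteSpace H]

/-- The deficiency subspace `ker (S* - z)`. -/
def defectSpace (S : H →ₗ.[ℂ] H) (z : ℂ) : Submodule ℂ H :=
  (LinearMap.ker (S†.toFun - z • S†.domain.subtype)).map S†.domain.subtype

/-- `ker (S* - iε)`. -/
abbrev defectPlus (S : H →ₗ.[ℂ] H) (ε : ℝ) : Submodule ℂ H :=
  defectSpace S (Complex.I * ε)

/-- `ker (S* + iε)`. -/
abbrev defectMinus (S : H →ₗ.[ℂ] H) (ε : ℝ) : Submodule ℂ H :=
  defectSpace S (-(Complex.I * ε))

/-- The map `1 - U` on `ker (S* - iε)`. -/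
def oneSubUnitary (S : H →ₗ.[ℂ] H) (ε : ℝ) (U : defectPlus S ε ≃ₗᵢ[ℂ] defectMinus S ε) :
    defectPlus S ε →ₗ[ℂ] H :=
  (defectPlus S ε).subtype - (defectMinus S ε).subtype ∘ₗ U.toLinearEquiv.toLinearMap

/-- The unitary `U : ker (S* - iε) → ker (S* + iε)` is the von Neumann parameter of the
extension `A` of `S`: the domain of `A` is `D(S̄) + (1 - U) ker (S* - iε)`, and
`A (f + u - U u) = S̄ f + iε u + iε U u`. -/
structure IsVonNeumannParameter (S A : H →ₗ.[ℂ] H) (ε : ℝ)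
    (U : defectPlus S ε ≃ₗᵢ[ℂ] defectMinus S ε) : Prop where
  domain_eq : A.domain = S.closure.domain ⊔ LinearMap.range (oneSubUnitary S ε U)
  apply_eq : ∀ (g : A.domain) (f : S.closure.domain) (u : defectPlus S ε),
    (g : H) = f + oneSubUnitary S ε U u →
      A g = S.closure f + (Complex.I * ε) • (u : H) + (Complex.I * ε) • (U u : H)

theorem IsVonNeumannParameter.sub_mem {S A : H →ₗ.[ℂ] H} {ε : ℝ}
    {U : defectPlus S ε ≃ₗᵢ[ℂ] defectMinus S ε} (h : IsVonNeumannParameter S A ε U)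
    (u : defectPlus S ε) : (u : H) - (U u : H) ∈ A.domain := by
  rw [h.domain_eq]
  exact Submodule.mem_sup_right ⟨u, rfl⟩

/-- The self-adjoint operator `T` in a closed subspace of `ker S*` is the
Kreĭn–Višik–Birman parameter of the extension `A` of `S`, relative to the distinguished extension
whose inverse is `B`: the domain of `A` consists of the vectors `f + B (T u + w) + u` with
`f ∈ D(S̄)`, `u ∈ D(T)`, `w ∈ ker S* ∩ D(T)ᗮ`, and `A` maps such a vector to `S̄ f + T u + w`. -/
structure IsKVBParameter (S : H →ₗ.[ℂ] H) (B : H →L[ℂ] H) (A : H →ₗ.[ℂ] H)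
    (T : SelfAdjointIn (defectSpace S 0)) : Prop where
  mem_domain_iff : ∀ g : H, g ∈ A.domain ↔
    ∃ (f : S.closure.domain) (u : T.op.domain) (w : H),
      w ∈ defectSpace S 0 ⊓ T.domᗮ ∧ g = f + B ((T.op u : H) + w) + ((u : T.space) : H)
  apply_eq : ∀ (g : A.domain) (f : S.closure.domain) (u : T.op.domain) (w : H),
    w ∈ defectSpace S 0 ⊓ T.domᗮ → (g : H) = f + B ((T.op u : H) + w) + ((u : T.space) : H) →
      A g = S.closure f + (T.op u : H) + w

/-- The one-sided limit `ε ↓ 0`, as a filter on the positive reals. -/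
def epsToZero : Filter (Set.Ioi (0 : ℝ)) :=
  comap ((↑) : Set.Ioi (0 : ℝ) → ℝ) (𝓝[>] 0)

end

end ExtensionTheory

open ExtensionTheory

/-! Write `A` for the extension and `B` for the inverse of the distinguished extension. Both extend
`S`, so `B (S̄ f) = f` and `1 - BA` annihilates `D(S̄)`. Hence `(1 - BA)(u_ε - U_ε u_ε) = (1 - BA)
g` for every `ε`: the limits are of constant families. On the other side `1 - BA` strips `f + B(Tu +
w)` from a Birman decomposition (`oneSubComp_eq`), so the constant is its component `u`. Since `u ∈
ker S*` is orthogonal to `ran S̄`, pairing it with the two expressions for `A g` gives `⟨u, Tu⟩ =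
⟨u, A g⟩ = iε⟨u, u_ε + U_ε u_ε⟩`.

The remaining work is existence and uniqueness of the parameters. `U_ε` is the Cayley transform of
`A` restricted to `ker (S* - iε)`; it is handled through the relation `(u - v, iε(u + v)) ∈ graph
A`, which forces `v = U_ε u`. `T` is `(1 - BA) g ↦ P A g`, with `P` the projection onto the closure
of `ran (1 - BA)`; symmetry of `A` and `B` makes it well defined and symmetric, and maximality of
`A` makes it self-adjoint. -/

namespace ExtensionTheory

open ComplexConjugate

/-! ### Regular points, deficiency subspaces and the orthogonal decomposition -/

noncomputable section

variable {H : Type*} [NormedAddCommGroup H] [InnerProductSpace ℂ H]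

/-- The map `A - z` on the domain of `A`. -/
def shift (A : H →ₗ.[ℂ] H) (z : ℂ) : A.domain →ₗ[ℂ] H :=
  A.toFun - z • A.domain.subtype

theorem shift_apply (A : H →ₗ.[ℂ] H) (z : ℂ) (x : A.domain) :
    shift A z x = A x - z • (x : H) := rfl

theorem oneSubComp_apply (B : H →L[ℂ] H) (A : H →ₗ.[ℂ] H) (x : A.domain) :
    oneSubComp B A x = (x : H) - B (A x) := rfl

/-- Every non-real number is a point of regular type of a symmetric operator. -/
theorem isRegularPoint_of_im_ne_zero {A : H →ₗ.[ℂ] H} (hA : A.IsFormalAdjoint A) {z : ℂ}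
    (hz : z.im ≠ 0) : IsRegularPoint A z := by
  refine ⟨|z.im|, abs_pos.2 hz, fun x => ?_⟩
  rcases eq_or_ne (x : H) 0 with h0 | h0
  · rw [h0]; simp
  have hpos : 0 < ‖(x : H)‖ := norm_pos_iff.2 h0
  -- Symmetry makes `⟨x, A x⟩` real, so only `z` contributes to the imaginary part below.
  have hreal : (inner ℂ (x : H) (A x)).im = 0 := by
    have h1 := inner_conj_symm (𝕜 := ℂ) (A x) (x : H)
    have h2 := congrArg Complex.im (hA x x)
    have h3 := congrArg Complex.im h1
    rw [Complex.conj_im] at h3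
    linarith
  have him : (inner ℂ (x : H) (A x - z • (x : H))).im = -(z.im * ‖(x : H)‖ ^ 2) := by
    rw [inner_sub_right, inner_smul_right, inner_self_eq_norm_sq_to_K, Complex.sub_im, hreal]
    norm_cast
    simp [Complex.mul_im]
    norm_cast
    simp
  have h1 : |z.im| * ‖(x : H)‖ ^ 2 ≤ ‖(x : H)‖ * ‖A x - z • (x : H)‖ := by
    calc |z.im| * ‖(x : H)‖ ^ 2 = |(inner ℂ (x : H) (A x - z • (x : H))).im| := by
          rw [him, abs_neg, abs_mul, abs_of_nonneg (sq_nonneg ‖(x : H)‖)]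
      _ ≤ ‖inner ℂ (x : H) (A x - z • (x : H))‖ := Complex.abs_im_le_norm _
      _ ≤ _ := norm_inner_le_norm _ _
  refine le_of_mul_le_mul_left ?_ hpos
  linarith

theorem shift_injective {A : H →ₗ.[ℂ] H} {z : ℂ} (h : IsRegularPoint A z) :
    Function.Injective (shift A z) := by
  obtain ⟨c, hc, h⟩ := h
  rw [injective_iff_map_eq_zero]
  intro x hx
  have := h x
  rw [← shift_apply, hx, norm_zero] at this
  have h0 : ‖(x : H)‖ = 0 := by
    have := norm_nonneg (x : H)
    nlinarith
  exact Subtype.ext (norm_eq_zero.1 h0)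

theorem closure_eq_self {A : H →ₗ.[ℂ] H} (hA : A.IsClosed) : A.closure = A := by
  refine LinearPMap.eq_of_eq_graph ?_
  rw [← hA.isClosable.graph_closure_eq_closure_graph]
  exact hA.submodule_topologicalClosure_eq

variable [CompleteSpace H]

/-- The range of `A - z` is closed if `A` is closed and `z` is a point of regular type. -/
theorem isClosed_range_shift {A : H →ₗ.[ℂ] H} (hA : A.IsClosed) {z : ℂ}
    (h : IsRegularPoint A z) : IsClosed (LinearMap.range (shift A z) : Set H) := by
  obtain ⟨c, hc, h⟩ := h
  refine IsSeqClosed.isClosed fun y p hy hp => ?_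
  choose x hx using hy
  -- The lower bound controls preimages by images, so the preimages form a Cauchy sequence.
  have hcau : CauchySeq fun n => (x n : H) := by
    rw [Metric.cauchySeq_iff']
    intro ε hε
    obtain ⟨N, hN⟩ := Metric.cauchySeq_iff'.1 hp.cauchySeq (c * ε) (by positivity)
    refine ⟨N, fun n hn => ?_⟩
    have h1 := h (x n - x N)
    rw [← shift_apply, map_sub, hx, hx] at h1
    have h2 := hN n hn
    rw [dist_eq_norm] at h2 ⊢
    exact lt_of_mul_lt_mul_left (h1.trans_lt h2) hc.le
  obtain ⟨q, hq⟩ := cauchySeq_tendsto_of_complete hcau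
  have hgr : Tendsto (fun n => ((x n : H), A (x n))) atTop (𝓝 (q, p + z • q)) := by
    refine hq.prodMk_nhds ((hp.add (hq.const_smul z)).congr fun n => ?_)
    rw [← hx n, shift_apply, sub_add_cancel]
  have hmem : (q, p + z • q) ∈ A.graph :=
    hA.mem_of_tendsto hgr (Eventually.of_forall fun n => A.mem_graph (x n))
  obtain ⟨g, hg1, hg2⟩ := A.mem_graph_iff.1 hmem
  exact ⟨g, by rw [shift_apply, hg2, hg1]; exact add_sub_cancel_right _ _⟩

theorem isFormalAdjoint_of_isSelfAdjoint {A : H →ₗ.[ℂ] H} (hA : IsSelfAdjoint A) :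
    A.IsFormalAdjoint A := by
  have h := LinearPMap.adjoint_isFormalAdjoint hA.dense_domain
  rwa [LinearPMap.isSelfAdjoint_def.1 hA] at h

/-- A self-adjoint operator is maximal: its graph contains every pair that is formally adjoint
to it. -/
theorem mem_graph_of_isSelfAdjoint {A : H →ₗ.[ℂ] H} (hA : IsSelfAdjoint A) {x y : H}
    (h : ∀ g : A.domain, inner ℂ y (g : H) = inner ℂ x (A g)) : (x, y) ∈ A.graph := by
  have h1 : x ∈ A†.domain := LinearPMap.mem_adjoint_domain_of_exists x ⟨y, h⟩
  have h2 : A† ⟨x, h1⟩ = y := LinearPMap.adjoint_apply_eq hA.dense_domain ⟨x, h1⟩ h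
  rw [← LinearPMap.isSelfAdjoint_def.1 hA, LinearPMap.mem_graph_iff]
  exact ⟨⟨x, h1⟩, rfl, h2⟩

theorem closure_le_of_isSelfAdjoint {S A : H →ₗ.[ℂ] H} (h : S ≤ A) (hA : IsSelfAdjoint A) :
    S.closure ≤ A := by
  have := hA.isClosed.isClosable.closure_mono h
  rwa [closure_eq_self hA.isClosed] at this

theorem mem_defectSpace_iff {S : H →ₗ.[ℂ] H} (hS : Dense (S.domain : Set H)) {z : ℂ} {x : H} :
    x ∈ defectSpace S z ↔ ∀ f : S.domain, inner ℂ x (S f - conj z • (f : H)) = 0 := by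
  constructor
  · rintro ⟨y, hy, rfl⟩ f
    have h1 : S† y = z • (y : H) := sub_eq_zero.1 hy
    have h2 := LinearPMap.adjoint_isFormalAdjoint hS y f
    rw [inner_sub_right, inner_smul_right, ← inner_smul_left, sub_eq_zero]
    rw [h1] at h2
    exact h2.symm
  · intro h
    have h' : ∀ f : S.domain, inner ℂ (z • x) (f : H) = inner ℂ x (S f) := by
      intro f
      have := h f
      rw [inner_sub_right, inner_smul_right, sub_eq_zero] at this
      rw [this, inner_smul_left]
    have h1 : x ∈ S†.domain := LinearPMap.mem_adjoint_domain_of_exists x ⟨_, h'⟩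
    have h2 : S† ⟨x, h1⟩ = z • x := LinearPMap.adjoint_apply_eq hS ⟨x, h1⟩ h'
    exact ⟨⟨x, h1⟩, sub_eq_zero.2 h2, rfl⟩

/-- The orthogonality condition is closed in `H × H`, so it passes from the graph of `S` to its
closure. -/
theorem mem_defectSpace_iff_closure {S : H →ₗ.[ℂ] H} (hS : Dense (S.domain : Set H))
    (hS' : S.IsClosable) {z : ℂ} {x : H} :
    x ∈ defectSpace S z ↔
      ∀ f : S.closure.domain, inner ℂ x (S.closure f - conj z • (f : H)) = 0 := by
  rw [mem_defectSpace_iff hS]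
  constructor
  · intro h f
    have hcl : IsClosed {p : H × H | inner ℂ x (p.2 - conj z • p.1) = 0} :=
      isClosed_eq (by fun_prop) continuous_const
    have hsub : (S.graph : Set (H × H)) ⊆ {p : H × H | inner ℂ x (p.2 - conj z • p.1) = 0} := by
      intro p hp
      obtain ⟨g, hg1, hg2⟩ := S.mem_graph_iff.1 hp
      have := h g
      rwa [hg1, hg2] at this
    have hmem : ((f : H), S.closure f) ∈ S.graph.topologicalClosure := by
      rw [hS'.graph_closure_eq_closure_graph]
      exact S.closure.mem_graph f
    exact closure_minimal hsub hcl hmem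
  · intro h f
    have hle := S.le_closure
    have := h ⟨f, hle.1 f.2⟩
    rwa [← hle.2 (x := f) (y := ⟨f, hle.1 f.2⟩) rfl] at this

theorem defectSpace_eq_orthogonal {S : H →ₗ.[ℂ] H} (hS : Dense (S.domain : Set H))
    (hS' : S.IsClosable) (z : ℂ) :
    defectSpace S z = (LinearMap.range (shift S.closure (conj z)))ᗮ := by
  ext x
  rw [mem_defectSpace_iff_closure hS hS', Submodule.mem_orthogonal']
  exact ⟨by rintro h _ ⟨f, rfl⟩; exact h f, fun h f => h _ ⟨f, rfl⟩⟩

/-- The orthogonal decomposition `H = ran (S̄ - z̄) ⊕ ker (S* - z)`. -/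
theorem exists_eq_shift_add {S : H →ₗ.[ℂ] H} (hS : Dense (S.domain : Set H))
    (hS' : S.IsClosable) {z : ℂ} (hz : IsRegularPoint S.closure (conj z)) (y : H) :
    ∃ f : S.closure.domain, ∃ n ∈ defectSpace S z, y = shift S.closure (conj z) f + n := by
  have hcl := isClosed_range_shift hS'.closure_isClosed hz
  have : CompleteSpace (LinearMap.range (shift S.closure (conj z))) := hcl.completeSpace_coe
  obtain ⟨a, ⟨f, rfl⟩, n, hn, hy⟩ :=
    (LinearMap.range (shift S.closure (conj z))).exists_add_mem_mem_orthogonal y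
  exact ⟨f, n, by rwa [defectSpace_eq_orthogonal hS hS'], hy⟩

/-- `A - z` is bijective if `A` is self-adjoint and `z` is not real. -/
theorem shift_bijective {A : H →ₗ.[ℂ] H} (hA : IsSelfAdjoint A) {z : ℂ} (hz : z.im ≠ 0) :
    Function.Bijective (shift A z) := by
  have hsym := isFormalAdjoint_of_isSelfAdjoint hA
  refine ⟨shift_injective (isRegularPoint_of_im_ne_zero hsym hz), fun y => ?_⟩
  have hcl := closure_eq_self hA.isClosed
  have hreg : IsRegularPoint A.closure (conj (conj z)) := by
    rw [hcl]; exact isRegularPoint_of_im_ne_zero hsym (by simpa using hz)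
  obtain ⟨f, n, hn, hy⟩ := exists_eq_shift_add hA.dense_domain hA.isClosed.isClosable hreg y
  rw [Complex.conj_conj] at hy
  -- Being orthogonal to `ran (A - z)`, `n` is an eigenvector of `A* = A` at the non-real number
  -- `z̄`, hence zero.
  have hn' : (n, conj z • n) ∈ A.graph := by
    refine mem_graph_of_isSelfAdjoint hA fun g => ?_
    have := (mem_defectSpace_iff hA.dense_domain).1 hn g
    rw [inner_sub_right, inner_smul_right, sub_eq_zero] at this
    rw [this, inner_smul_left]
  obtain ⟨g, hg1, hg2⟩ := A.mem_graph_iff.1 hn'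
  have hg0 : shift A (conj z) g = 0 := by rw [shift_apply, hg2, hg1]; exact sub_self _
  have hzc : (conj z).im ≠ 0 := by simpa using hz
  have : g = 0 := shift_injective (isRegularPoint_of_im_ne_zero hsym hzc) (by rw [hg0, map_zero])
  have hn0 : n = 0 := by simpa [this] using hg1.symm
  have hle : A.closure ≤ A := hcl.le
  refine ⟨⟨f, hle.1 f.2⟩, ?_⟩
  rw [hy, hn0, add_zero, shift_apply, shift_apply,
    hle.2 (x := f) (y := ⟨f, hle.1 f.2⟩) rfl]

end

/-! ### The Cayley transform -/

noncomputable section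

variable {H : Type*} [NormedAddCommGroup H] [InnerProductSpace ℂ H]

theorem conj_I_mul_ofReal (ε : ℝ) : conj (Complex.I * ε) = -(Complex.I * ε) := by simp

/-- Symmetry of `A` at `u - v`, with the sign change of `iε` under conjugation, gives `⟨u + v, u -
v⟩ + ⟨u - v, u + v⟩ = 0`, that is `2‖u‖² = 2‖v‖²`. -/
theorem norm_eq_of_sub_mem_graph {A : H →ₗ.[ℂ] H} (hA : A.IsFormalAdjoint A) {ε : ℝ} (hε : ε ≠ 0)
    {u v : H} (h : (u - v, (Complex.I * ε) • (u + v)) ∈ A.graph) : ‖u‖ = ‖v‖ := by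
  obtain ⟨g, hg1, hg2⟩ := A.mem_graph_iff.1 h
  have h1 := hA g g
  rw [hg2, hg1] at h1
  simp only [inner_smul_left, inner_smul_right, conj_I_mul_ofReal] at h1
  have hI : (Complex.I * ε : ℂ) ≠ 0 := mul_ne_zero Complex.I_ne_zero (by exact_mod_cast hε)
  have h2 : -(inner ℂ (u + v) (u - v)) = inner ℂ (u - v) (u + v) :=
    mul_left_cancel₀ hI (by rw [← h1]; ring)
  simp only [inner_add_left, inner_sub_left, inner_add_right, inner_sub_right] at h2
  have h3 : inner ℂ u u = inner ℂ v v := by linear_combination -h2 / 2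
  rw [inner_self_eq_norm_sq_to_K, inner_self_eq_norm_sq_to_K] at h3
  have h4 : ‖u‖ ^ 2 = ‖v‖ ^ 2 := by exact_mod_cast h3
  exact (sq_eq_sq₀ (norm_nonneg u) (norm_nonneg v)).1 h4

variable [CompleteSpace H]

/-- Symmetry of `A` tested against `f ∈ D(S)` reads `⟨u, S f + iε f⟩ = ⟨v, S f - iε f⟩`; the
vanishing of the two sides defines the two deficiency subspaces. -/
theorem mem_defectPlus_iff_of_sub_mem_graph {S A : H →ₗ.[ℂ] H} (hS : Dense (S.domain : Set H))
    (hSA : S ≤ A) (hA : A.IsFormalAdjoint A) {ε : ℝ} {u v : H}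
    (h : (u - v, (Complex.I * ε) • (u + v)) ∈ A.graph) :
    u ∈ defectPlus S ε ↔ v ∈ defectMinus S ε := by
  rw [mem_defectSpace_iff hS, mem_defectSpace_iff hS]
  obtain ⟨g, hg1, hg2⟩ := A.mem_graph_iff.1 h
  refine forall_congr' fun f => ?_
  have h1 := hA g ⟨f, hSA.1 f.2⟩
  rw [hg2, hg1, ← hSA.2 (x := f) (y := ⟨f, hSA.1 f.2⟩) rfl] at h1
  simp only [inner_smul_left, inner_sub_left, inner_add_left] at h1
  simp only [inner_sub_right, inner_smul_right, map_neg, conj_I_mul_ofReal, neg_neg] at h1 ⊢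
  exact ⟨fun h2 => by linear_combination h2 + h1, fun h2 => by linear_combination h2 - h1⟩

/-- `A - z` as a linear equivalence, for `A` self-adjoint and `z` not real. -/
def shiftEquiv {A : H →ₗ.[ℂ] H} (hA : IsSelfAdjoint A) {z : ℂ} (hz : z.im ≠ 0) :
    A.domain ≃ₗ[ℂ] H :=
  LinearEquiv.ofBijective (shift A z) (shift_bijective hA hz)

theorem apply_shiftEquiv_symm {A : H →ₗ.[ℂ] H} (hA : IsSelfAdjoint A) {z : ℂ} (hz : z.im ≠ 0)
    (y : H) : A ((shiftEquiv hA hz).symm y) = y + z • ((shiftEquiv hA hz).symm y : H) := by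
  have h : shift A z ((shiftEquiv hA hz).symm y) = y := (shiftEquiv hA hz).apply_symm_apply y
  rw [shift_apply] at h
  rw [← sub_eq_iff_eq_add, h]

section Cayley

variable {S A : H →ₗ.[ℂ] H} (hS : Dense (S.domain : Set H)) (hSA : S ≤ A) (hA : IsSelfAdjoint A)
  {ε : ℝ}

theorem im_I_mul_ne_zero (hε : 0 < ε) : (Complex.I * ε).im ≠ 0 := by
  simpa using hε.ne'

theorem im_neg_I_mul_ne_zero (hε : 0 < ε) : (-(Complex.I * ε)).im ≠ 0 := by
  simpa using hε.ne'

/-- The Cayley transform `1 - 2iε (A + iε)⁻¹` of a self-adjoint operator. -/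
def cayley (hε : 0 < ε) : H →ₗ[ℂ] H :=
  LinearMap.id - (2 * (Complex.I * ε)) •
    (A.domain.subtype ∘ₗ (shiftEquiv hA (im_neg_I_mul_ne_zero hε)).symm.toLinearMap)

/-- With `x = (A + iε)⁻¹ u` and `v = u - 2iεx`, one has `u - v = 2iεx` and `u + v = 2A x`. -/
theorem sub_cayley_mem_graph (hε : 0 < ε) (u : H) :
    (u - cayley hA hε u, (Complex.I * ε) • (u + cayley hA hε u)) ∈ A.graph := by
  set x := (shiftEquiv hA (im_neg_I_mul_ne_zero hε)).symm u with hx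
  have h1 : cayley hA hε u = u - (2 * (Complex.I * ε)) • (x : H) := rfl
  have h2 : A x = u + (-(Complex.I * ε)) • (x : H) := apply_shiftEquiv_symm hA _ u
  rw [LinearPMap.mem_graph_iff]
  refine ⟨(2 * (Complex.I * ε)) • x, ?_, ?_⟩
  · rw [h1]; simp
  · rw [LinearPMap.map_smul, h1, h2]
    module

-- Two such pairs with the same `u` differ by some `(x, -iεx)`, and `-iε` is not an eigenvalue of
-- `A`.
include hA in
theorem eq_cayley_of_mem_graph (hε : 0 < ε) {u v : H}
    (h : (u - v, (Complex.I * ε) • (u + v)) ∈ A.graph) : v = cayley hA hε u := by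
  have h1 := A.graph.sub_mem h (sub_cayley_mem_graph hA hε u)
  obtain ⟨g, hg1, hg2⟩ := A.mem_graph_iff.1 h1
  have h0 : shift A (-(Complex.I * ε)) g = 0 := by
    rw [shift_apply, hg2, hg1]
    simp only [Prod.fst_sub, Prod.snd_sub]
    module
  have hg : g = 0 := (shift_bijective hA (im_neg_I_mul_ne_zero hε)).1 (by rw [h0, map_zero])
  rw [hg] at hg1
  simp only [Prod.fst_sub, ZeroMemClass.coe_zero, sub_sub_sub_cancel_left] at hg1
  exact (sub_eq_zero.1 hg1.symm).symm

/-- The restriction of the Cayley transform to the deficiency subspace `ker (S* - iε)`. -/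
def vonNeumannUnitary (hε : 0 < ε) : defectPlus S ε ≃ₗᵢ[ℂ] defectMinus S ε :=
  LinearIsometryEquiv.ofSurjective
    { toLinearMap := (cayley hA hε).restrict fun u hu =>
        (mem_defectPlus_iff_of_sub_mem_graph hS hSA (isFormalAdjoint_of_isSelfAdjoint hA)
          (sub_cayley_mem_graph hA hε u)).1 hu
      norm_map' := fun u =>
        (norm_eq_of_sub_mem_graph (isFormalAdjoint_of_isSelfAdjoint hA) hε.ne'
          (sub_cayley_mem_graph hA hε u)).symm }
    (by
      intro v
      -- The preimage is `u = x + v`; the graph relation then requires `(A - iε) x = 2iεv`.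
      set x := (2 * (Complex.I * ε)) • (shiftEquiv hA (im_I_mul_ne_zero hε)).symm (v : H)
      have h : ((x : H) + v - v, (Complex.I * ε) • ((x : H) + v + v)) ∈ A.graph := by
        rw [LinearPMap.mem_graph_iff]
        refine ⟨x, by simp, ?_⟩
        rw [LinearPMap.map_smul, apply_shiftEquiv_symm]
        simp only [x, Submodule.coe_smul]
        module
      have hu := (mem_defectPlus_iff_of_sub_mem_graph hS hSA
        (isFormalAdjoint_of_isSelfAdjoint hA) h).2 v.2
      exact ⟨⟨_, hu⟩, Subtype.ext (eq_cayley_of_mem_graph hA hε h).symm⟩)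

theorem coe_vonNeumannUnitary (hε : 0 < ε) (u : defectPlus S ε) :
    (vonNeumannUnitary hS hSA hA hε u : H) = cayley hA hε u := rfl

end Cayley

/-! ### The von Neumann parameter -/

section VonNeumann

variable {S A : H →ₗ.[ℂ] H} {ε : ℝ} {U : defectPlus S ε ≃ₗᵢ[ℂ] defectMinus S ε}

theorem IsVonNeumannParameter.mem_graph (h : IsVonNeumannParameter S A ε U)
    (u : defectPlus S ε) :
    ((u : H) - (U u : H), (Complex.I * ε) • ((u : H) + (U u : H))) ∈ A.graph := by
  rw [LinearPMap.mem_graph_iff]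
  refine ⟨⟨_, h.sub_mem u⟩, rfl, ?_⟩
  have h1 := h.apply_eq ⟨_, h.sub_mem u⟩ 0 u
    (by rw [ZeroMemClass.coe_zero, zero_add]; rfl)
  rw [LinearPMap.map_zero, zero_add, ← smul_add] at h1
  exact h1

theorem IsVonNeumannParameter.apply_add (h : IsVonNeumannParameter S A ε U) (g : A.domain)
    (f : S.closure.domain) (u : defectPlus S ε) (hg : (g : H) = f + ((u : H) - (U u : H))) :
    A g = S.closure f + (Complex.I * ε) • ((u : H) + (U u : H)) := by
  rw [h.apply_eq g f u hg, smul_add, add_assoc]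

/-- The components of a vector with respect to a von Neumann parameter are unique. -/
theorem IsVonNeumannParameter.existsUnique (hS : Dense (S.domain : Set H)) (hS' : S.IsClosable)
    (h : IsVonNeumannParameter S A ε U) (hε : 0 < ε) (g : A.domain) :
    ∃! p : S.closure.domain × defectPlus S ε,
      (g : H) = (p.1 : H) + ((p.2 : H) - (U p.2 : H)) := by
  have hmem : (g : H) ∈ S.closure.domain ⊔ LinearMap.range (oneSubUnitary S ε U) :=
    h.domain_eq ▸ g.2
  obtain ⟨f, hf, _, ⟨u, rfl⟩, hg⟩ := Submodule.mem_sup.1 hmem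
  refine ⟨(⟨f, hf⟩, u), hg.symm, ?_⟩
  rintro ⟨f', u'⟩ hg'
  have h1 := h.apply_add g ⟨f, hf⟩ u hg.symm
  have h2 := h.apply_add g f' u' hg'
  have hI : (Complex.I * ε : ℂ) ≠ 0 := mul_ne_zero Complex.I_ne_zero (by exact_mod_cast hε.ne')
  have hsub : (f' : H) - f + (((u' : H) - U u') - ((u : H) - U u)) = 0 := by
    have : (f : H) + ((u : H) - U u) = f' + ((u' : H) - U u') := hg.trans hg'
    linear_combination (norm := module) -this
  have happ : S.closure f' - S.closure ⟨f, hf⟩ +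
      (Complex.I * ε) • (((u' : H) + U u') - ((u : H) + U u)) = 0 := by
    have := h1.symm.trans h2
    linear_combination (norm := module) -this
  -- Eliminating between `hsub` and `happ` gives `(S̄ + iε)(f' - f) = -2iε(u' - u)`, while `u' - u`
  -- is orthogonal to `ran (S̄ + iε)`.
  have horth := (mem_defectSpace_iff_closure hS hS').1 (u' - u).2 (f' - ⟨f, hf⟩)
  have hu0 : (u' : H) - u = 0 := by
    have hsum : S.closure (f' - ⟨f, hf⟩) - conj (Complex.I * (ε : ℂ)) • ((f' - ⟨f, hf⟩ :
        S.closure.domain) : H) = -((2 * (Complex.I * ε)) • ((u' : H) - u)) := by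
      rw [conj_I_mul_ofReal, LinearPMap.map_sub, Submodule.coe_sub]
      linear_combination (norm := module) happ + (Complex.I * ε : ℂ) • hsub
    rw [hsum, inner_neg_right, inner_smul_right, neg_eq_zero, mul_eq_zero] at horth
    rcases horth with h0 | h0
    · exact absurd h0 (mul_ne_zero two_ne_zero hI)
    · exact inner_self_eq_zero.1 h0
  have hu : u' = u := Subtype.ext (sub_eq_zero.1 hu0)
  subst hu
  have hf' : f' = ⟨f, hf⟩ := Subtype.ext (by simpa [sub_eq_zero] using hsub)
  rw [hf']

/-- A self-adjoint extension has a unique von Neumann parameter. -/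
theorem existsUnique_isVonNeumannParameter (hS : Dense (S.domain : Set H)) (hSA : S ≤ A)
    (hA : IsSelfAdjoint A) (hε : 0 < ε) :
    ∃! U : defectPlus S ε ≃ₗᵢ[ℂ] defectMinus S ε, IsVonNeumannParameter S A ε U := by
  have hsym := isFormalAdjoint_of_isSelfAdjoint hA
  have hS' : S.IsClosable := hA.isClosed.isClosable.leIsClosable hSA
  have hle := closure_le_of_isSelfAdjoint hSA hA
  have hI : (Complex.I * ε : ℂ) ≠ 0 := mul_ne_zero Complex.I_ne_zero (by exact_mod_cast hε.ne')
  have hgraph : ∀ f : S.closure.domain, ((f : H), S.closure f) ∈ A.graph := fun f =>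
    LinearPMap.le_graph_of_le hle (S.closure.mem_graph f)
  refine ⟨vonNeumannUnitary hS hSA hA hε, ⟨le_antisymm ?_ ?_, ?_⟩, ?_⟩
  · intro g hg
    have hreg : IsRegularPoint S.closure (conj (Complex.I * ε)) := by
      obtain ⟨c, hc, h⟩ := isRegularPoint_of_im_ne_zero hsym (im_neg_I_mul_ne_zero hε)
      refine ⟨c, hc, fun f => ?_⟩
      have := h ⟨f, hle.1 f.2⟩
      rwa [← hle.2 (x := f) (y := ⟨f, hle.1 f.2⟩) rfl, ← conj_I_mul_ofReal] at this
    obtain ⟨f, n, hn, hy⟩ := exists_eq_shift_add hS hS' hreg (shift A (-(Complex.I * ε)) ⟨g, hg⟩)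
    -- The factor comes from `(A + iε)(u - U u) = 2iεu`, which has to equal `n`.
    let u : defectPlus S ε := ⟨(2 * (Complex.I * ε))⁻¹ • n, Submodule.smul_mem _ _ hn⟩
    have hu : (2 * (Complex.I * ε)) • (u : H) = n :=
      smul_inv_smul₀ (mul_ne_zero two_ne_zero hI) n
    refine Submodule.mem_sup.2 ⟨f, f.2, _, ⟨u, rfl⟩, ?_⟩
    obtain ⟨x, hx1, hx2⟩ := A.mem_graph_iff.1
      (A.graph.add_mem (hgraph f) (sub_cayley_mem_graph hA hε u))
    have : x = ⟨g, hg⟩ := by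
      apply (shift_bijective hA (im_neg_I_mul_ne_zero hε)).1
      rw [hy, shift_apply, hx2, hx1, ← hu, shift_apply, conj_I_mul_ofReal]
      simp only [Prod.fst_add, Prod.snd_add]
      module
    rw [this] at hx1
    exact hx1.symm
  · refine sup_le hle.1 ?_
    rintro _ ⟨u, rfl⟩
    exact LinearPMap.mem_domain_of_mem_graph (sub_cayley_mem_graph hA hε u)
  · intro g f u hg
    have h1 := A.graph.add_mem (hgraph f) (sub_cayley_mem_graph hA hε u)
    have h2 := A.mem_graph g
    have h3 := A.mem_graph_snd_inj h2 h1 hg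
    rw [h3, coe_vonNeumannUnitary, add_assoc, ← smul_add]
  · intro V hV
    ext u
    rw [coe_vonNeumannUnitary]
    exact eq_cayley_of_mem_graph hA hε (hV.mem_graph u)

end VonNeumann

end

/-! ### The operator `(1 - BA) g ↦ P A g` -/

noncomputable section

theorem isSelfAdjoint_of_maximal {K : Type*} [NormedAddCommGroup K] [InnerProductSpace ℂ K]
    [CompleteSpace K] {T : K →ₗ.[ℂ] K} (hd : Dense (T.domain : Set K)) (hT : T.IsFormalAdjoint T)
    (hmax : ∀ v t : K, (∀ x : T.domain, inner ℂ t (x : K) = inner ℂ v (T x)) → v ∈ T.domain) :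
    IsSelfAdjoint T := by
  rw [LinearPMap.isSelfAdjoint_def]
  have hle : T ≤ T† := hT.le_adjoint hd
  refine (LinearPMap.eq_of_le_of_domain_eq hle (le_antisymm hle.1 fun v hv => ?_)).symm
  exact hmax v (T† ⟨v, hv⟩) fun x => LinearPMap.adjoint_isFormalAdjoint hd ⟨v, hv⟩ x

variable {H : Type*} [NormedAddCommGroup H] [InnerProductSpace ℂ H]

theorem IsBoundedInverse.inner_left {A : H →ₗ.[ℂ] H} {B : H →L[ℂ] H} (h : IsBoundedInverse A B)
    (hA : A.IsFormalAdjoint A) (x y : H) : inner ℂ (B x) y = inner ℂ x (B y) := by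
  have := hA ⟨B x, h.mem_domain x⟩ ⟨B y, h.mem_domain y⟩
  rw [h.right_inv, h.right_inv] at this
  exact this.symm

theorem IsBoundedInverse.apply_of_le {S A : H →ₗ.[ℂ] H} {B : H →L[ℂ] H} (h : IsBoundedInverse A B)
    (hS : S ≤ A) (f : S.domain) : B (S f) = f := by
  rw [hS.2 (x := f) (y := ⟨f, hS.1 f.2⟩) rfl, h.left_inv]

/-- `⟨(1 - BA) h, A g⟩ = ⟨A h, (1 - BA) g⟩` for symmetric `A` and `B`. -/
theorem inner_oneSubComp {A : H →ₗ.[ℂ] H} (hA : A.IsFormalAdjoint A) {B : H →L[ℂ] H}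
    (hB : ∀ x y, inner ℂ (B x) y = inner ℂ x (B y)) (h g : A.domain) :
    inner ℂ (oneSubComp B A h) (A g) = inner ℂ (A h) (oneSubComp B A g) := by
  rw [oneSubComp_apply, oneSubComp_apply, inner_sub_left, inner_sub_right, hA h g, hB]

theorem inner_projection_left {K : Submodule ℂ H} [K.HasOrthogonalProjection] {x : H} (hx : x ∈ K)
    (y : H) : inner ℂ (K.orthogonalProjectionOnto y : H) x = inner ℂ y x :=
  Submodule.inner_orthogonalProjectionOnto_eq_of_mem_right (⟨x, hx⟩ : K) y

theorem inner_projection_right {K : Submodule ℂ H} [K.HasOrthogonalProjection] {x : H} (hx : x ∈ K)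
    (y : H) : inner ℂ x (K.orthogonalProjectionOnto y : H) = inner ℂ x y :=
  Submodule.inner_orthogonalProjectionOnto_eq_of_mem_left (⟨x, hx⟩ : K) y

/-- The closure of the range of `1 - BA`. -/
def birmanSpace (B : H →L[ℂ] H) (A : H →ₗ.[ℂ] H) : Submodule ℂ H := (LinearMap.range (oneSubComp B A)).topologicalClosure

theorem oneSubComp_mem_birmanSpace (B : H →L[ℂ] H) (A : H →ₗ.[ℂ] H) (g : A.domain) :
    oneSubComp B A g ∈ birmanSpace B A :=
  Submodule.le_topologicalClosure _ ⟨g, rfl⟩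

theorem mem_birmanSpace_orthogonal_iff {B : H →L[ℂ] H} {A : H →ₗ.[ℂ] H} {w : H} :
    w ∈ (birmanSpace B A)ᗮ ↔ ∀ g : A.domain, inner ℂ w (oneSubComp B A g) = 0 := by
  rw [birmanSpace, Submodule.orthogonal_closure, Submodule.mem_orthogonal']
  exact ⟨fun h g => h _ ⟨g, rfl⟩, by rintro h _ ⟨g, rfl⟩; exact h g⟩

variable [CompleteSpace H]

theorem inner_closure_of_mem_defectSpace_zero {S : H →ₗ.[ℂ] H} (hS : Dense (S.domain : Set H))
    (hS' : S.IsClosable) {x : H} (hx : x ∈ defectSpace S 0) (f : S.closure.domain) :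
    inner ℂ x (S.closure f) = 0 := by
  have := (mem_defectSpace_iff_closure hS hS').1 hx f
  rwa [map_zero, zero_smul, sub_zero] at this

section Birman

variable (B : H →L[ℂ] H) (A : H →ₗ.[ℂ] H)

instance : CompleteSpace (birmanSpace B A) :=
  (Submodule.isClosed_topologicalClosure _).completeSpace_coe

/-- The graph of the operator `(1 - BA) g ↦ P A g`, with `P` the projection onto
`birmanSpace B A`. -/
def birmanGraph : Submodule ℂ (birmanSpace B A × birmanSpace B A) :=
  LinearMap.range (((oneSubComp B A).codRestrict _ (oneSubComp_mem_birmanSpace B A)).prod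
    ((birmanSpace B A).orthogonalProjectionOnto.toLinearMap ∘ₗ A.toFun))

/-- The operator `(1 - BA) g ↦ P A g` in `birmanSpace B A`. -/
def birmanOp : birmanSpace B A →ₗ.[ℂ] birmanSpace B A := (birmanGraph B A).toLinearPMap

variable {B A}

theorem mem_birmanGraph_iff {p : birmanSpace B A × birmanSpace B A} :
    p ∈ birmanGraph B A ↔ ∃ g : A.domain, oneSubComp B A g = p.1 ∧
      (birmanSpace B A).orthogonalProjectionOnto (A g) = p.2 := by
  constructor
  · rintro ⟨g, rfl⟩
    exact ⟨g, rfl, rfl⟩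
  · rintro ⟨g, h1, h2⟩
    exact ⟨g, Prod.ext (Subtype.ext h1) h2⟩

variable (hA : A.IsFormalAdjoint A) (hB : ∀ x y, inner ℂ (B x) y = inner ℂ x (B y))

include hA hB in
theorem mem_graph_birmanOp {p : birmanSpace B A × birmanSpace B A} :
    p ∈ (birmanOp B A).graph ↔ ∃ g : A.domain, oneSubComp B A g = p.1 ∧
      (birmanSpace B A).orthogonalProjectionOnto (A g) = p.2 := by
  have hgr : (birmanOp B A).graph = birmanGraph B A := by
    refine Submodule.toLinearPMap_graph_eq _ fun p hp h0 => ?_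
    obtain ⟨g, hg1, hg2⟩ := mem_birmanGraph_iff.1 hp
    rw [h0, ZeroMemClass.coe_zero] at hg1
    -- Well-definedness: if `(1 - BA) g = 0`, then `⟨A g, (1 - BA) k⟩ = ⟨(1 - BA) g, A k⟩ = 0`, so
    -- `P A g = 0`.
    have horth : A g ∈ (birmanSpace B A)ᗮ := mem_birmanSpace_orthogonal_iff.2 fun k => by
      rw [← inner_oneSubComp hA hB, hg1, inner_zero_left]
    rw [← hg2, Submodule.orthogonalProjectionOnto_apply_of_mem_orthogonal horth]
  rw [hgr, mem_birmanGraph_iff]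

include hA hB in
theorem exists_of_birmanOp (x : (birmanOp B A).domain) : ∃ g : A.domain,
    oneSubComp B A g = ((x : birmanSpace B A) : H) ∧
      (birmanSpace B A).orthogonalProjectionOnto (A g) = birmanOp B A x :=
  (mem_graph_birmanOp hA hB).1 ((birmanOp B A).mem_graph x)

include hA hB in
theorem exists_birmanOp (g : A.domain) : ∃ x : (birmanOp B A).domain,
    oneSubComp B A g = ((x : birmanSpace B A) : H) ∧
      (birmanSpace B A).orthogonalProjectionOnto (A g) = birmanOp B A x := by
  have h := (mem_graph_birmanOp hA hB
    (p := (⟨_, oneSubComp_mem_birmanSpace B A g⟩, _))).2 ⟨g, rfl, rfl⟩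
  obtain ⟨x, hx1, hx2⟩ := (birmanOp B A).mem_graph_iff.1 h
  exact ⟨x, by rw [hx1], hx2.symm⟩

include hA hB in
theorem map_domain_birmanOp :
    (birmanOp B A).domain.map (birmanSpace B A).subtype = LinearMap.range (oneSubComp B A) := by
  ext v
  constructor
  · rintro ⟨x, hx, rfl⟩
    obtain ⟨g, hg, -⟩ := exists_of_birmanOp hA hB ⟨x, hx⟩
    exact ⟨g, hg⟩
  · rintro ⟨g, rfl⟩
    obtain ⟨x, hx, -⟩ := exists_birmanOp hA hB g
    exact ⟨x, x.2, hx.symm⟩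

include hA hB in
theorem isFormalAdjoint_birmanOp : (birmanOp B A).IsFormalAdjoint (birmanOp B A) := by
  intro x y
  obtain ⟨g, hg1, hg2⟩ := exists_of_birmanOp hA hB x
  obtain ⟨k, hk1, hk2⟩ := exists_of_birmanOp hA hB y
  rw [Submodule.coe_inner, Submodule.coe_inner, ← hg2, ← hk2, inner_projection_left (Subtype.mem _),
    inner_projection_right (Subtype.mem _), ← hg1, ← hk1, inner_oneSubComp hA hB]

include hB in
theorem isSelfAdjoint_birmanOp (hA' : IsSelfAdjoint A) : IsSelfAdjoint (birmanOp B A) := by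
  have hA := isFormalAdjoint_of_isSelfAdjoint hA'
  refine isSelfAdjoint_of_maximal ?_ (isFormalAdjoint_birmanOp hA hB) ?_
  · rw [Subtype.dense_iff]
    intro v hv
    have h : v ∈ _root_.closure
        ((birmanOp B A).domain.map (birmanSpace B A).subtype : Set H) := by
      rw [map_domain_birmanOp hA hB]
      exact hv
    exact h
  · intro v t h
    -- Solving `(1 - BA) g = v`, `A g = t` forces `g = v + B t`; maximality of `A` puts this vector
    -- in its domain.
    have hmem : ((v : H) + B t, (t : H)) ∈ A.graph := by
      refine mem_graph_of_isSelfAdjoint hA' fun g => ?_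
      obtain ⟨x, hx1, hx2⟩ := exists_birmanOp hA hB g
      have h1 := h x
      rw [Submodule.coe_inner, Submodule.coe_inner, ← hx1, ← hx2, inner_projection_right v.2,
        oneSubComp_apply, inner_sub_right] at h1
      rw [inner_add_left, hB, ← h1, sub_add_cancel]
    obtain ⟨g, hg1, hg2⟩ := A.mem_graph_iff.1 hmem
    obtain ⟨x, hx1, -⟩ := exists_birmanOp hA hB g
    have : v = x := Subtype.ext (by
      rw [← hx1, oneSubComp_apply, hg1, hg2]; exact (add_sub_cancel_right _ _).symm)
    rw [this]
    exact x.2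

end Birman

/-! ### The Kreĭn–Višik–Birman parameter -/

section KVB

variable {S A : H →ₗ.[ℂ] H} {B : H →L[ℂ] H}

/-- `⟨BA g, S f⟩ = ⟨A g, B S f⟩ = ⟨A g, f⟩ = ⟨g, S f⟩`. -/
theorem oneSubComp_mem_defectSpace (hS : Dense (S.domain : Set H)) (hSA : S ≤ A)
    (hA : A.IsFormalAdjoint A) (hB : ∀ x y, inner ℂ (B x) y = inner ℂ x (B y))
    (hBS : ∀ f : S.domain, B (S f) = f) (g : A.domain) :
    oneSubComp B A g ∈ defectSpace S 0 := by
  refine (mem_defectSpace_iff hS).2 fun f => ?_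
  have h := hA g ⟨f, hSA.1 f.2⟩
  rw [← hSA.2 (x := f) (y := ⟨f, hSA.1 f.2⟩) rfl] at h
  rw [map_zero, zero_smul, sub_zero, oneSubComp_apply, inner_sub_left, hB, hBS, ← h]
  exact sub_self _

/-- The Kreĭn–Višik–Birman parameter of a self-adjoint extension. -/
def birmanParameter (hS : Dense (S.domain : Set H)) (hSA : S ≤ A)
    (hA : IsSelfAdjoint A) (hB : ∀ x y, inner ℂ (B x) y = inner ℂ x (B y))
    (hBS : ∀ f : S.domain, B (S f) = f) : SelfAdjointIn (defectSpace S 0) where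
  space := birmanSpace B A
  space_le := by
    have hcl : IsClosed (defectSpace S 0 : Set H) := by
      rw [defectSpace_eq_orthogonal hS (hA.isClosed.isClosable.leIsClosable hSA)]
      exact Submodule.isClosed_orthogonal _
    refine Submodule.topologicalClosure_minimal _ ?_ hcl
    rintro _ ⟨g, rfl⟩
    exact oneSubComp_mem_defectSpace hS hSA (isFormalAdjoint_of_isSelfAdjoint hA) hB hBS g
  isClosed := Submodule.isClosed_topologicalClosure _
  op := birmanOp B A
  isSelfAdjoint := isSelfAdjoint_birmanOp hB hA

theorem isKVBParameter_birmanParameter (hS : Dense (S.domain : Set H))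
    (hreg : IsRegularPoint S.closure 0) (hSA : S ≤ A)
    (hA : IsSelfAdjoint A) (hB : ∀ x y, inner ℂ (B x) y = inner ℂ x (B y))
    (hBS : ∀ f : S.domain, B (S f) = f) (hBS' : ∀ f : S.closure.domain, B (S.closure f) = f) :
    IsKVBParameter S B A (birmanParameter hS hSA hA hB hBS) := by
  have hsym := isFormalAdjoint_of_isSelfAdjoint hA
  have hS' := hA.isClosed.isClosable.leIsClosable hSA
  have hle := closure_le_of_isSelfAdjoint hSA hA
  set T := birmanParameter hS hSA hA hB hBS
  have hdom : T.dom = LinearMap.range (oneSubComp B A) := map_domain_birmanOp hsym hB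
  have hdom' : T.domᗮ = (birmanSpace B A)ᗮ := by
    rw [hdom, birmanSpace, Submodule.orthogonal_closure]
  have hgraph : ∀ (f : S.closure.domain) (u : T.op.domain) (w : H),
      w ∈ defectSpace S 0 ⊓ T.domᗮ →
      ((f : H) + B ((T.op u : H) + w) + ((u : T.space) : H),
        S.closure f + (T.op u : H) + w) ∈ A.graph := by
    intro f u w hw
    have h1 : ((f : H), S.closure f) ∈ A.graph :=
      LinearPMap.le_graph_of_le hle (S.closure.mem_graph f)
    have h2 : (B ((T.op u : H) + w) + ((u : T.space) : H), (T.op u : H) + w) ∈ A.graph := by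
      -- Tested against `k`, the claim splits into `w ⊥ (1 - BA) k` and the symmetry relation `⟨Tu,
      -- (1 - BA) k⟩ = ⟨u, A k⟩`.
      refine mem_graph_of_isSelfAdjoint hA fun k => ?_
      obtain ⟨x, hx1, hx2⟩ := exists_birmanOp hsym hB k
      have hw' := mem_birmanSpace_orthogonal_iff.1 (hdom' ▸ hw.2) k
      have h3 : inner ℂ (T.op u : H) (oneSubComp B A k) = inner ℂ ((u : T.space) : H) (A k) := by
        rw [← inner_projection_right (K := birmanSpace B A) (u : T.space).2, hx2, hx1]
        exact isFormalAdjoint_birmanOp hsym hB u x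
      rw [oneSubComp_apply, inner_sub_right] at hw' h3
      rw [inner_add_left _ _ (A k), hB, inner_add_left, inner_add_left]
      linear_combination hw' + h3
    have := A.graph.add_mem h1 h2
    rwa [Prod.mk_add_mk, ← add_assoc, ← add_assoc] at this
  refine ⟨fun g => ⟨fun hg => ?_, ?_⟩, fun g f u w hw hg => ?_⟩
  · obtain ⟨u, hu1, hu2⟩ := exists_birmanOp hsym hB ⟨g, hg⟩
    have hreg' : IsRegularPoint S.closure (conj 0) := by rwa [map_zero]
    obtain ⟨f, n, hn, hy⟩ := exists_eq_shift_add hS hS' hreg' (A ⟨g, hg⟩)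
    rw [shift_apply, map_zero, zero_smul, sub_zero] at hy
    have hK : birmanSpace B A ≤ defectSpace S 0 := T.space_le
    have hPf : (birmanSpace B A).orthogonalProjectionOnto (S.closure f) = 0 := by
      apply Submodule.orthogonalProjectionOnto_apply_of_mem_orthogonal
      exact (Submodule.mem_orthogonal _ _).2 fun v hv =>
        inner_closure_of_mem_defectSpace_zero hS hS' (hK hv) f
    have hTu : (birmanSpace B A).orthogonalProjectionOnto n = birmanOp B A u := by
      rw [← hu2, hy, map_add, hPf, zero_add]
    -- In `A g = S̄ f + n` the projection `P` kills `S̄ f`, so `Tu = P n` and `w = n - P n`.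
    refine ⟨f, u, n - (birmanOp B A u : H), ⟨sub_mem hn (hK (Subtype.mem _)), ?_⟩, ?_⟩
    · rw [hdom', ← hTu]
      exact Submodule.sub_starProjection_mem_orthogonal n
    · have h1 : (T.op u : H) + (n - (birmanOp B A u : H)) = n := add_sub_cancel _ _
      rw [h1]
      have h2 : g - B (A ⟨g, hg⟩) = ((u : birmanSpace B A) : H) := hu1
      rw [hy, map_add, hBS'] at h2
      exact sub_eq_iff_eq_add'.1 h2
  · rintro ⟨f, u, w, hw, rfl⟩
    exact LinearPMap.mem_domain_of_mem_graph (hgraph f u w hw)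
  · exact A.mem_graph_snd_inj (A.mem_graph g) (hgraph f u w hw) hg

variable {T : SelfAdjointIn (defectSpace S 0)}

theorem IsKVBParameter.oneSubComp_eq (hT : IsKVBParameter S B A T)
    (hBS' : ∀ f : S.closure.domain, B (S.closure f) = f) (g : A.domain)
    (f : S.closure.domain) (u : T.op.domain) (w : H) (hw : w ∈ defectSpace S 0 ⊓ T.domᗮ)
    (hg : (g : H) = f + B ((T.op u : H) + w) + ((u : T.space) : H)) :
    oneSubComp B A g = ((u : T.space) : H) := by
  rw [oneSubComp_apply, hT.apply_eq g f u w hw hg, hg, add_assoc (S.closure f), map_add B (S.closure f), hBS']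
  exact add_sub_cancel_left _ _

theorem SelfAdjointIn.coe_mem_dom {N : Submodule ℂ H} (T : SelfAdjointIn N) (u : T.op.domain) :
    ((u : T.space) : H) ∈ T.dom := ⟨u, u.2, rfl⟩

/-- Every `g` in the domain of `A` has `(1 - BA) g` as its component in the domain of `T`, and
`A g - T (1 - BA) g` is orthogonal to the domain of `T`. -/
theorem IsKVBParameter.exists_component (hS : Dense (S.domain : Set H)) (hS' : S.IsClosable)
    (hT : IsKVBParameter S B A T) (hBS' : ∀ f : S.closure.domain, B (S.closure f) = f)
    (g : A.domain) : ∃ u : T.op.domain, oneSubComp B A g = ((u : T.space) : H) ∧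
      ∀ v ∈ T.dom, inner ℂ v (A g) = inner ℂ v (T.op u : H) := by
  obtain ⟨f, u, w, hw, hg⟩ := (hT.mem_domain_iff g).1 g.2
  refine ⟨u, hT.oneSubComp_eq hBS' g f u w hw hg, ?_⟩
  rintro _ ⟨v, hv, rfl⟩
  have hv' : ((v : T.space) : H) ∈ T.dom := ⟨v, hv, rfl⟩
  rw [Submodule.subtype_apply, hT.apply_eq g f u w hw hg, inner_add_right, inner_add_right,
    inner_closure_of_mem_defectSpace_zero hS hS' (T.space_le v.2),
    (Submodule.mem_orthogonal _ _).1 hw.2 _ hv', zero_add, add_zero]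

/-- The lift is `g = B(Tu) + u`, the Birman decomposition with `f = 0` and `w = 0`. -/
theorem IsKVBParameter.exists_lift (hT : IsKVBParameter S B A T)
    (hBS' : ∀ f : S.closure.domain, B (S.closure f) = f) (u : T.op.domain) :
    ∃ g : A.domain, oneSubComp B A g = ((u : T.space) : H) ∧ A g = (T.op u : H) := by
  have hg : (B ((T.op u : H) + 0) + ((u : T.space) : H)) =
      ((0 : S.closure.domain) : H) + B ((T.op u : H) + 0) + ((u : T.space) : H) := by
    rw [ZeroMemClass.coe_zero, zero_add]
  have hmem := (hT.mem_domain_iff _).2 ⟨0, u, 0, Submodule.zero_mem _, hg⟩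
  refine ⟨⟨_, hmem⟩, hT.oneSubComp_eq hBS' _ 0 u 0 (Submodule.zero_mem _) hg, ?_⟩
  rw [hT.apply_eq _ 0 u 0 (Submodule.zero_mem _) hg, LinearPMap.map_zero, zero_add, add_zero]

theorem IsKVBParameter.dom_eq (hS : Dense (S.domain : Set H)) (hS' : S.IsClosable)
    (hT : IsKVBParameter S B A T) (hBS' : ∀ f : S.closure.domain, B (S.closure f) = f) :
    T.dom = LinearMap.range (oneSubComp B A) := by
  ext v
  constructor
  · rintro ⟨u, hu, rfl⟩
    obtain ⟨g, hg, -⟩ := hT.exists_lift hBS' ⟨u, hu⟩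
    exact ⟨g, hg⟩
  · rintro ⟨g, rfl⟩
    obtain ⟨u, hu, -⟩ := hT.exists_component hS hS' hBS' g
    rw [hu]
    exact T.coe_mem_dom u

/-- A self-adjoint operator is densely defined, so `T.dom` determines the space in which `T` acts.
-/
theorem SelfAdjointIn.space_eq {N : Submodule ℂ H} (T : SelfAdjointIn N) :
    T.space = T.dom.topologicalClosure := by
  have : CompleteSpace T.space := T.isClosed.completeSpace_coe
  apply le_antisymm
  · intro v hv
    exact (Subtype.dense_iff.1 T.isSelfAdjoint.dense_domain) hv
  · refine Submodule.topologicalClosure_minimal _ ?_ T.isClosed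
    rintro _ ⟨u, -, rfl⟩
    exact u.2

theorem SelfAdjointIn.ext_of_space {N : Submodule ℂ H} {T T' : SelfAdjointIn N}
    (hs : T.space = T'.space) (hd : T.dom = T'.dom)
    (h : ∀ (u : T.op.domain) (u' : T'.op.domain), ((u : T.space) : H) = ((u' : T'.space) : H) →
      (T.op u : H) = (T'.op u' : H)) : T = T' := by
  obtain ⟨K, hK, hc, op, hsa⟩ := T
  obtain ⟨K', hK', hc', op', hsa'⟩ := T'
  obtain rfl : K = K' := hs
  congr 1
  refine LinearPMap.ext (Submodule.map_injective_of_injective K.injective_subtype hd) ?_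
  intro x hx hx'
  exact Subtype.ext (h ⟨x, hx⟩ ⟨x, hx'⟩ rfl)

theorem IsKVBParameter.unique {T T' : SelfAdjointIn (defectSpace S 0)}
    (hS : Dense (S.domain : Set H)) (hS' : S.IsClosable)
    (hT : IsKVBParameter S B A T) (hT' : IsKVBParameter S B A T')
    (hBS' : ∀ f : S.closure.domain, B (S.closure f) = f) : T = T' := by
  have hd : T.dom = T'.dom := by rw [hT.dom_eq hS hS' hBS', hT'.dom_eq hS hS' hBS']
  have hs : T.space = T'.space := by rw [T.space_eq, T'.space_eq, hd]
  refine SelfAdjointIn.ext_of_space hs hd fun u u' huu' => ?_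
  obtain ⟨g, hg1, hg2⟩ := hT.exists_lift hBS' u
  obtain ⟨v, hv1, hv2⟩ := hT'.exists_component hS hS' hBS' g
  have hvu : v = u' := Subtype.ext (Subtype.ext (by rw [← hv1, hg1, huu']))
  subst hvu
  rw [hg2] at hv2
  -- The difference of the two values lies in the common space and, by `hv2`, is orthogonal to the
  -- dense domain.
  have hmem : (T.op u : H) - (T'.op v : H) ∈ T'.space :=
    sub_mem (hs ▸ Subtype.mem _) (Subtype.mem _)
  have horth : (T.op u : H) - (T'.op v : H) ∈ T'.spaceᗮ := by
    have heq : T'.spaceᗮ = T'.domᗮ := by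
      conv_lhs => rw [T'.space_eq, Submodule.orthogonal_closure]
    refine heq ▸ (Submodule.mem_orthogonal _ _).2 fun x hx => ?_
    rw [inner_sub_right, hv2 x hx, sub_self]
  exact sub_eq_zero.1 (inner_self_eq_zero.1 ((Submodule.mem_orthogonal _ _).1 horth _ hmem))

end KVB

end

/-- Needed for uniqueness of limits along `epsToZero`. -/
theorem epsToZero_neBot : epsToZero.NeBot := by
  refine comap_coe_neBot_of_le_principal ?_
  exact inf_le_right

end ExtensionTheory

/-! ### The limit formulas -/

theorem mainTheorem5 {H : Type*} [NormedAddCommGroup H] [InnerProductSpace ℂ H] [CompleteSpace H]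
    (S : H →ₗ.[ℂ] H) (hS_dense : Dense (S.domain : Set H)) (hS_symm : S.IsFormalAdjoint S)
    (hS_reg : IsRegularPoint S.closure 0)
    (hS_def : 1 ≤ Module.rank ℂ (defectSpace S 0))
    (SD : H →ₗ.[ℂ] H) (hSD_ext : S ≤ SD) (hSD_sa : IsSelfAdjoint SD)
    (SDinv : H →L[ℂ] H) (hSD_inv : IsBoundedInverse SD SDinv)
    (St : H →ₗ.[ℂ] H) (hSt_ext : S ≤ St) (hSt_sa : IsSelfAdjoint St) :
    -- the extension parameters of `St` exist and are unique
    (∀ ε : ℝ, 0 < ε → ∃! U : defectPlus S ε ≃ₗᵢ[ℂ] defectMinus S ε,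
      IsVonNeumannParameter S St ε U) ∧
    (∃! T : SelfAdjointIn (defectSpace S 0), IsKVBParameter S SDinv St T) ∧
    ∀ (U : ∀ ε : Set.Ioi (0 : ℝ), defectPlus S ε ≃ₗᵢ[ℂ] defectMinus S ε)
      (hU : ∀ ε : Set.Ioi (0 : ℝ), IsVonNeumannParameter S St ε (U ε))
      (T : SelfAdjointIn (defectSpace S 0)) (_hT : IsKVBParameter S SDinv St T),
      -- every `g ∈ D(St)` is uniquely decomposed as `g = f + u - U u`
      (∀ (ε : Set.Ioi (0 : ℝ)) (g : St.domain),
        ∃! p : S.closure.domain × defectPlus S ε,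
          (g : H) = (p.1 : H) + ((p.2 : H) - (U ε p.2 : H))) ∧
      -- `f ε g` and `u ε g` are the components of `g` at `ε`
      ∀ (f : ∀ _ : Set.Ioi (0 : ℝ), St.domain → S.closure.domain)
        (u : ∀ ε : Set.Ioi (0 : ℝ), St.domain → defectPlus S ε)
        (_hdec : ∀ (ε : Set.Ioi (0 : ℝ)) (g : St.domain),
          (g : H) = (f ε g : H) + ((u ε g : H) - (U ε (u ε g) : H))),
        ((T.dom : Set H) =
          {v : H | v ∈ defectSpace S 0 ∧ ∃ g : St.domain,
            Tendsto (fun ε : Set.Ioi (0 : ℝ) =>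
              oneSubComp SDinv St ⟨(u ε g : H) - (U ε (u ε g) : H), (hU ε).sub_mem (u ε g)⟩)
              epsToZero (𝓝 v)}) ∧
        ∀ g : St.domain, ∃ v : T.op.domain,
          Tendsto (fun ε : Set.Ioi (0 : ℝ) =>
            oneSubComp SDinv St ⟨(u ε g : H) - (U ε (u ε g) : H), (hU ε).sub_mem (u ε g)⟩)
            epsToZero (𝓝 ((v : T.space) : H)) ∧
          Tendsto (fun ε : Set.Ioi (0 : ℝ) =>
            Complex.I * ((ε : ℝ) : ℂ) * inner ℂ
              (oneSubComp SDinv St ⟨(u ε g : H) - (U ε (u ε g) : H), (hU ε).sub_mem (u ε g)⟩)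
              ((u ε g : H) + (U ε (u ε g) : H)))
            epsToZero (𝓝 (inner ℂ ((v : T.space) : H) (T.op v : H))) := by
  have hS' : S.IsClosable := hSt_sa.isClosed.isClosable.leIsClosable hSt_ext
  have hSt_symm := isFormalAdjoint_of_isSelfAdjoint hSt_sa
  have hB := hSD_inv.inner_left (isFormalAdjoint_of_isSelfAdjoint hSD_sa)
  have hBS := hSD_inv.apply_of_le hSD_ext
  have hBS' := hSD_inv.apply_of_le (closure_le_of_isSelfAdjoint hSD_ext hSD_sa)
  have hSt_le := closure_le_of_isSelfAdjoint hSt_ext hSt_sa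
  refine ⟨fun ε hε => existsUnique_isVonNeumannParameter hS_dense hSt_ext hSt_sa hε,
    ⟨_, isKVBParameter_birmanParameter hS_dense hS_reg hSt_ext hSt_sa hB hBS hBS',
      fun T hT => hT.unique hS_dense hS'
        (isKVBParameter_birmanParameter hS_dense hS_reg hSt_ext hSt_sa hB hBS hBS') hBS'⟩, ?_⟩
  intro U hU T hT
  refine ⟨fun ε g => (hU ε).existsUnique hS_dense hS' ε.2 g, ?_⟩
  intro f u hdec
  have := epsToZero_neBot
  -- `1 - SDinv St` annihilates `D(S̄)`, so that the expression does not depend on `ε`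
  have hconst : ∀ (g : St.domain) (ε : Set.Ioi (0 : ℝ)),
      oneSubComp SDinv St ⟨(u ε g : H) - (U ε (u ε g) : H), (hU ε).sub_mem (u ε g)⟩ =
        oneSubComp SDinv St g := by
    intro g ε
    have h1 : g = ⟨f ε g, hSt_le.1 (f ε g).2⟩ +
        ⟨(u ε g : H) - (U ε (u ε g) : H), (hU ε).sub_mem (u ε g)⟩ := Subtype.ext (hdec ε g)
    conv_rhs => rw [h1, map_add, oneSubComp_apply SDinv St ⟨f ε g, _⟩,
      ← hSt_le.2 (x := f ε g) (y := ⟨f ε g, hSt_le.1 (f ε g).2⟩) rfl, hBS', sub_self, zero_add]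
  have hlim : ∀ g : St.domain, Tendsto (fun ε : Set.Ioi (0 : ℝ) =>
      oneSubComp SDinv St ⟨(u ε g : H) - (U ε (u ε g) : H), (hU ε).sub_mem (u ε g)⟩)
      epsToZero (𝓝 (oneSubComp SDinv St g)) := fun g =>
    tendsto_const_nhds.congr fun ε => (hconst g ε).symm
  refine ⟨?_, fun g => ?_⟩
  · ext v
    rw [hT.dom_eq hS_dense hS' hBS']
    constructor
    · rintro ⟨g, rfl⟩
      exact ⟨oneSubComp_mem_defectSpace hS_dense hSt_ext hSt_symm hB hBS g, g, hlim g⟩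
    · rintro ⟨-, g, hg⟩
      exact ⟨g, tendsto_nhds_unique (hlim g) hg⟩
  · obtain ⟨v, hv1, hv2⟩ := hT.exists_component hS_dense hS' hBS' g
    -- The form identity also holds exactly at each `ε`: in `A g = S̄ f_ε + iε(u_ε + U_ε u_ε)` the
    -- first term is orthogonal to `v ∈ ker S*`.
    refine ⟨v, hv1 ▸ hlim g, tendsto_const_nhds.congr fun ε => ?_⟩
    rw [hconst, hv1, ← inner_smul_right, ← hv2 _ (T.coe_mem_dom v),
      (hU ε).apply_add g (f ε g) (u ε g) (hdec ε g), inner_add_right,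
      inner_closure_of_mem_defectSpace_zero hS_dense hS' (T.space_le (v : T.space).2), zero_add]
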